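/- Let $n\ge 0$ and $\mathbb{R}_+=[0,\infty)$. For $p\ge 1$ let $\boldsymbol\pi=(\pi_1,\dots,\pi_p)$ be a probability vector, $\boldsymbol T$ a $p\times p$ sub-intensity matrix (non-negative off-diagonal entries, exit rates $\boldsymbol t=-\boldsymbol T\boldsymbol e\ge 0$ where $\boldsymbol e=(1,\dots,1)^\top$, and from every state a state with positive exit rate can be reached through positive off-diagonal entries, i.e. all $p$ states are transient), and $\boldsymbol R=(r_{ik})$ a $p\times n$ matrix with non-negative entries. For $0<\alpha\le 1$, $\mathrm{MPH}^*_\alpha(\boldsymbol\pi,\boldsymbol T,\boldsymbol R)$ is the distribution on $\mathbb{R}_+^n$ characterized by the joint Laplace transform $$\int e^{-\langle \boldsymbol y,\boldsymbol\theta\rangle}\,d\mu(\boldsymbol y)=\boldsymbol\pi\,\bigl(\boldsymbol\Delta(\boldsymbol R\boldsymbol\theta)^\alpha-\boldsymbol T\bigr)^{-1}\boldsymbol t,\qquad \boldsymbol\theta\in\mathbb{R}_+^n,$$ where $\boldsymbol\Delta(\boldsymbol R\boldsymbol\theta)^\alpha$ is the diagonal matrix with entries $\bigl(\sum_k r_{ik}\theta_k\bigr)^\alpha$,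 $i=1,\dots,p$. Let $\mathrm{MPH}^*_\alpha$ be the class of all these distributions, with $p,\boldsymbol\pi,\boldsymbol T,\boldsymbol R$ arbitrary, and for $\boldsymbol\nu=(\nu_1,\dots,\nu_n)$ with all $\nu_i>0$ let $\mathrm{MPH}_\alpha^{*1/\boldsymbol\nu}$ be the class of the laws of $(X_1^{1/\nu_1},\dots,X_n^{1/\nu_n})$ where the law of $(X_1,\dots,X_n)$ belongs to $\mathrm{MPH}^*_\alpha$. Then, in the topology of weak convergence on the set of all Borel probability measures on $\mathbb{R}_+^n$: (i) The union of the classes $\mathrm{MPH}^*_\alpha$ over $0<\alpha<1$ is dense (hence so is the union over $0<\alpha\le1$). (ii) For every fixed $\alpha\in(0,1]$, the union of the classes $\mathrm{MPH}_\alpha^{*1/\boldsymbol\nu}$ over all $\boldsymbol\nu\in(0,\infty)^n$ is dense. (iii) For every fixed vector $(\beta_1,\dots,\beta_n)\in(0,\infty)^n$, the union of the classes $\mathrm{MPH}_\alpha^{*1/\boldsymbol\nu}$ over all $0<\alpha<1$ and all $\boldsymbol\nu\in(0,\infty)^n$ with $(\alpha/\nu_1,\dots,\alpha/\nu_n)=(\beta_1,\dots,\beta_n)$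 is dense; this remains true if only those members are used none of whose marginals is the point mass at $0$. -/

import Mathlib

open MeasureTheory
open scoped NNReal Matrix

namespace FractionalPhaseType

/-- The column vector `t = -T e` of the intensities of jumping to the absorbing state. -/
def exitRate {p : ℕ} (T : Matrix (Fin p) (Fin p) ℝ) (i : Fin p) : ℝ :=
  -∑ j, T i j

/-- `T` is the `p × p` sub-intensity matrix of the transient states of a Markov jump process on
`p` transient states and one absorbing state. Transience of the `p` states means that from each of
them the absorbing state can be reached through jumps of positive rate. -/
structure IsSubIntensity {p : ℕ} (T : Matrix (Fin p) (Fin p) ℝ) : Prop where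
  offDiag_nonneg : ∀ i j, i ≠ j → 0 ≤ T i j
  exitRate_nonneg : ∀ i, 0 ≤ exitRate T i
  transient : ∀ i, ∃ j, Relation.ReflTransGen (fun a b => 0 < T a b) i j ∧ 0 < exitRate T j

/-- A probability vector: an initial distribution concentrated on the transient states. -/
structure IsInitial {p : ℕ} (π : Fin p → ℝ) : Prop where
  nonneg : ∀ i, 0 ≤ π i
  sum_eq_one : ∑ i, π i = 1

/-- The diagonal matrix `Δ(R θ)^α`, whose `i`-th entry is `⟨r_i, θ⟩ ^ α`,
with `r_i` the `i`-th row of `R`. -/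
noncomputable def rewardDiag {p n : ℕ} (α : ℝ) (R : Matrix (Fin p) (Fin n) ℝ)
    (θ : Fin n → ℝ≥0) : Matrix (Fin p) (Fin p) ℝ :=
  Matrix.diagonal fun i => (∑ k, R i k * (θ k : ℝ)) ^ α

/-- The matrix that is inverted in the Laplace transform of a multivariate fractional phase-type
distribution is nonsingular, so `⁻¹` below is the true inverse. -/
theorem isUnit_det_rewardDiag_sub {p n : ℕ} (α : ℝ) {T : Matrix (Fin p) (Fin p) ℝ}
    (hT : IsSubIntensity T) {R : Matrix (Fin p) (Fin n) ℝ} (hR : ∀ i k, 0 ≤ R i k)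
    (θ : Fin n → ℝ≥0) : IsUnit (rewardDiag α R θ - T).det := by
  rw [isUnit_iff_ne_zero]
  intro hdet
  obtain ⟨v, hv0, hv⟩ := Matrix.exists_mulVec_eq_zero_iff.mpr hdet
  obtain ⟨i₀, hi₀⟩ := Function.ne_iff.mp hv0
  obtain ⟨m, -, hm⟩ := Finset.exists_max_image Finset.univ (fun i => |v i|) ⟨i₀, Finset.mem_univ _⟩
  have hmpos : 0 < |v m| := lt_of_lt_of_le (abs_pos.mpr hi₀) (hm i₀ (Finset.mem_univ _))
  -- the key estimate at a state where `|v|` is maximal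
  have key : ∀ i, |v i| = |v m| →
      exitRate T i * |v m| + ∑ j ∈ Finset.univ.erase i, T i j * (|v m| - |v j|) ≤ 0 := by
    intro i hi
    set d : ℝ := (∑ k, R i k * (θ k : ℝ)) ^ α with hd
    have hd0 : 0 ≤ d := Real.rpow_nonneg
      (Finset.sum_nonneg fun k _ => mul_nonneg (hR i k) (θ k).2) α
    have h1 : (d - T i i) * v i = ∑ j ∈ Finset.univ.erase i, T i j * v j := by
      have h := congrFun hv i
      rw [Matrix.sub_mulVec, Pi.sub_apply, rewardDiag, Matrix.mulVec_diagonal] at h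
      simp only [Pi.zero_apply, Matrix.mulVec, dotProduct] at h
      rw [← Finset.add_sum_erase _ _ (Finset.mem_univ i)] at h
      linarith
    have h2 : (d - T i i) * |v i| ≤ ∑ j ∈ Finset.univ.erase i, T i j * |v j| := by
      calc (d - T i i) * |v i| ≤ |d - T i i| * |v i| :=
            mul_le_mul_of_nonneg_right (le_abs_self _) (abs_nonneg _)
        _ = |∑ j ∈ Finset.univ.erase i, T i j * v j| := by rw [← abs_mul, h1]
        _ ≤ ∑ j ∈ Finset.univ.erase i, |T i j * v j| := Finset.abs_sum_le_sum_abs _ _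
        _ = ∑ j ∈ Finset.univ.erase i, T i j * |v j| := by
            refine Finset.sum_congr rfl fun j hj => ?_
            rw [abs_mul, abs_of_nonneg (hT.offDiag_nonneg i j (Finset.ne_of_mem_erase hj).symm)]
    have h3 : exitRate T i = -T i i - ∑ j ∈ Finset.univ.erase i, T i j := by
      rw [exitRate, ← Finset.add_sum_erase _ _ (Finset.mem_univ i)]; ring
    have h4 : 0 ≤ d * |v m| := mul_nonneg hd0 hmpos.le
    simp only [mul_sub, Finset.sum_sub_distrib, ← Finset.sum_mul]
    rw [h3]
    rw [hi] at h2
    nlinarith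
  have hsum : ∀ i, ∀ j ∈ Finset.univ.erase i, 0 ≤ T i j * (|v m| - |v j|) := fun i j hj =>
    mul_nonneg (hT.offDiag_nonneg i j (Finset.ne_of_mem_erase hj).symm)
      (sub_nonneg.mpr (hm j (Finset.mem_univ _)))
  have hall : ∀ j, Relation.ReflTransGen (fun a b => 0 < T a b) m j → |v j| = |v m| := by
    intro j hpath
    induction hpath with
    | refl => rfl
    | @tail b c _ hbc hb =>
      by_contra hne
      have hcb : c ≠ b := by rintro rfl; exact hne hb
      have h := key b hb
      have h5 := Finset.single_le_sum (hsum b) (Finset.mem_erase.mpr ⟨hcb, Finset.mem_univ c⟩)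
      have h6 := mul_nonneg (hT.exitRate_nonneg b) hmpos.le
      have h7 := mul_pos hbc (sub_pos.mpr (lt_of_le_of_ne (hm c (Finset.mem_univ _)) hne))
      linarith
  obtain ⟨j, hpath, hj⟩ := hT.transient m
  have hjm := hall j hpath
  have h := key j hjm
  have h5 := Finset.sum_nonneg (hsum j)
  have h6 := mul_pos hj hmpos
  linarith

/-- `μ` is the multivariate fractional phase-type distribution `MPH*_α(π, T, R)`: the distribution
on `ℝ₊ⁿ` of the rewards collected until absorption, characterized by its joint Laplace transform
`θ ↦ π (Δ(R θ)^α - T)⁻¹ t`. -/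
def HasMPHStarLaw {p n : ℕ} (α : ℝ) (π : Fin p → ℝ) (T : Matrix (Fin p) (Fin p) ℝ)
    (R : Matrix (Fin p) (Fin n) ℝ) (μ : ProbabilityMeasure (Fin n → ℝ≥0)) : Prop :=
  ∀ θ : Fin n → ℝ≥0,
    ∫ y, Real.exp (-∑ k, (y k : ℝ) * (θ k : ℝ)) ∂(μ : Measure (Fin n → ℝ≥0)) =
      π ⬝ᵥ ((rewardDiag α R θ - T)⁻¹ *ᵥ exitRate T)

/-- The class `MPH*_α` of distributions on `ℝ₊ⁿ`: the parameters `π`, `T`, `R` and the number `p`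
of transient states are arbitrary, and `α` is fixed. -/
def MPHStar (n : ℕ) (α : ℝ) : Set (ProbabilityMeasure (Fin n → ℝ≥0)) :=
  {μ | ∃ (p : ℕ) (π : Fin p → ℝ) (T : Matrix (Fin p) (Fin p) ℝ) (R : Matrix (Fin p) (Fin n) ℝ),
    IsInitial π ∧ IsSubIntensity T ∧ (∀ i k, 0 ≤ R i k) ∧ HasMPHStarLaw α π T R μ}

/-- The componentwise power `x ↦ x^(1/ν) = (x_1^(1/ν_1), …, x_n^(1/ν_n))`. -/
noncomputable def invPow {n : ℕ} (ν : Fin n → ℝ) (x : Fin n → ℝ≥0) : Fin n → ℝ≥0 :=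
  fun k => x k ^ (1 / ν k)

theorem measurable_invPow {n : ℕ} (ν : Fin n → ℝ) : Measurable (invPow ν) :=
  measurable_pi_lambda _ fun k => (measurable_pi_apply k).pow_const _

/-- The class `MPH*_α^(1/ν)` for fixed `α` and `ν`: the laws of `X^(1/ν)`, where the law of `X` is
in `MPH*_α`. -/
def MPHStarPow (n : ℕ) (α : ℝ) (ν : Fin n → ℝ) : Set (ProbabilityMeasure (Fin n → ℝ≥0)) :=
  (fun μ => μ.map (measurable_invPow ν).aemeasurable) '' MPHStar n α

end FractionalPhaseType

/-! Take a random vector `F` with finitely many values and an independent scalar `S ≥ 0` with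
Laplace transform `(1 + s ^ α / m) ^ (-m)`. Given `F = b`, the transform of `F · S` at `θ` is that
of `S` at `⟨b, θ⟩`. This is what a chain of `m` stages of rate `m`, all with reward row `b`,
produces. Mixing over `b` places such chains in parallel, so the law of `F · S` is in `MPHStar n α`
(`map_simpleFunc_mul_mem_MPHStar`).

Density follows once powers of `S` degenerate to `1` (`TendstoOne`), because laws of simple
functions are already dense. For (i) and (iii), `α → 1` and `m → ∞`, so the transform tends to `e ^
(-s)` and `S → 1` in probability. For (ii), `S` is fixed and almost surely positive, and the
exponents `1 / ν` tend to `0`. Using `F ^ ν` as rewards makes the componentwise power return `F · S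
^ (1 / ν)`.

The existence of `S` is obtained on `[0, 1]` via `y = e ^ (-x)`, where Laplace transforms become
moment functions and compactness supplies limits: Sibuya laws, their geometric sums, then
Mittag-Leffler laws and their convolutions. -/

namespace FractionalPhaseType

/-! ### Moment functions on `[0, 1]` and Mittag-Leffler laws -/

section Moments

open Filter Topology unitInterval

/-- `f` is the moment function `s ↦ ∫ y ^ s` on `s > 0` of a probability measure on `[0, 1]`. -/
def IsMomentFunction (f : ℝ → ℝ) : Prop :=
  ∃ μ : ProbabilityMeasure I, ∀ s : ℝ, 0 < s → ∫ y, (y : ℝ) ^ s ∂(μ : Measure I) = f s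

theorem continuous_unitInterval_rpow {s : ℝ} (hs : 0 < s) :
    Continuous fun y : I => (y : ℝ) ^ s :=
  (Real.continuous_rpow_const hs.le).comp continuous_subtype_val

theorem integrable_unitInterval_rpow (μ : Measure I) [IsFiniteMeasure μ] {s : ℝ} (hs : 0 < s) :
    Integrable (fun y : I => (y : ℝ) ^ s) μ := by
  refine Integrable.of_bound (continuous_unitInterval_rpow hs).aestronglyMeasurable 1
    (ae_of_all _ fun y => ?_)
  rw [Real.norm_of_nonneg (Real.rpow_nonneg y.2.1 s)]
  exact Real.rpow_le_one y.2.1 y.2.2 hs.le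

theorem isMomentFunction_congr {f g : ℝ → ℝ} (hf : IsMomentFunction f)
    (h : ∀ s, 0 < s → f s = g s) : IsMomentFunction g := by
  obtain ⟨μ, hμ⟩ := hf
  exact ⟨μ, fun s hs => (hμ s hs).trans (h s hs)⟩

theorem IsMomentFunction.mem_Icc {f : ℝ → ℝ} (hf : IsMomentFunction f) {s : ℝ} (hs : 0 < s) :
    f s ∈ Set.Icc 0 1 := by
  obtain ⟨μ, hμ⟩ := hf
  rw [← hμ s hs]
  refine ⟨integral_nonneg fun y => Real.rpow_nonneg y.2.1 s, ?_⟩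
  calc ∫ y : I, (y : ℝ) ^ s ∂(μ : Measure I) ≤ ∫ _ : I, (1 : ℝ) ∂(μ : Measure I) :=
        integral_mono (integrable_unitInterval_rpow _ hs) (integrable_const _)
          fun y => Real.rpow_le_one y.2.1 y.2.2 hs.le
    _ = 1 := by simp

theorem isMomentFunction_rpow (y : I) : IsMomentFunction fun s => (y : ℝ) ^ s :=
  ⟨⟨Measure.dirac y, inferInstance⟩, fun s _ => by
    simp [integral_dirac]⟩

theorem isMomentFunction_one : IsMomentFunction fun _ => 1 :=
  isMomentFunction_congr (isMomentFunction_rpow 1) fun s _ => by simp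

theorem isMomentFunction_zero : IsMomentFunction fun _ => 0 :=
  isMomentFunction_congr (isMomentFunction_rpow 0) fun s hs => by simp [hs.ne']

/-- The product of independent variables in `[0, 1]`; under `y = e ^ (-x)` this is convolution. -/
theorem IsMomentFunction.mul {f g : ℝ → ℝ} (hf : IsMomentFunction f) (hg : IsMomentFunction g) :
    IsMomentFunction fun s => f s * g s := by
  obtain ⟨μ, hμ⟩ := hf
  obtain ⟨ν, hν⟩ := hg
  refine ⟨⟨((μ : Measure I).prod (ν : Measure I)).map (fun z => z.1 * z.2),
    Measure.isProbabilityMeasure_map (by fun_prop)⟩, fun s hs => ?_⟩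
  change ∫ y : I, (y : ℝ) ^ s ∂(((μ : Measure I).prod (ν : Measure I)).map
    (fun z => z.1 * z.2)) = _
  rw [integral_map (by fun_prop) (continuous_unitInterval_rpow hs).aestronglyMeasurable]
  beta_reduce
  rw [← hμ s hs, ← hν s hs, ← integral_prod_mul]
  exact integral_congr_ae (ae_of_all _ fun z => Real.mul_rpow z.1.2.1 z.2.2.1)

theorem IsMomentFunction.pow {f : ℝ → ℝ} (hf : IsMomentFunction f) (m : ℕ) :
    IsMomentFunction fun s => f s ^ m := by
  induction m with
  | zero => simpa using isMomentFunction_one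
  | succ m ih => simpa only [pow_succ] using ih.mul hf

theorem IsMomentFunction.convexComb {f g : ℝ → ℝ} (hf : IsMomentFunction f)
    (hg : IsMomentFunction g) {a b : ℝ} (ha : 0 ≤ a) (hb : 0 ≤ b) (hab : a + b = 1) :
    IsMomentFunction fun s => a * f s + b * g s := by
  obtain ⟨μ, hμ⟩ := hf
  obtain ⟨ν, hν⟩ := hg
  refine ⟨⟨ENNReal.ofReal a • (μ : Measure I) + ENNReal.ofReal b • (ν : Measure I), ⟨?_⟩⟩,
    fun s hs => ?_⟩
  · simp [← ENNReal.ofReal_add ha hb, hab]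
  · change ∫ y : I, (y : ℝ) ^ s
      ∂(ENNReal.ofReal a • (μ : Measure I) + ENNReal.ofReal b • (ν : Measure I)) = _
    rw [integral_add_measure, integral_smul_measure, integral_smul_measure, hμ s hs, hν s hs,
      ENNReal.toReal_ofReal ha, ENNReal.toReal_ofReal hb, smul_eq_mul, smul_eq_mul]
    · exact (integrable_unitInterval_rpow _ hs).smul_measure ENNReal.ofReal_ne_top
    · exact (integrable_unitInterval_rpow _ hs).smul_measure ENNReal.ofReal_ne_top

/-- Moment functions are closed under pointwise limits, since the space of probability measures on
`[0, 1]` is compact. -/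
theorem isMomentFunction_of_tendsto {F : ℕ → ℝ → ℝ} {f : ℝ → ℝ}
    (hF : ∀ j, IsMomentFunction (F j))
    (h : ∀ s, 0 < s → Tendsto (fun j => F j s) atTop (𝓝 (f s))) : IsMomentFunction f := by
  choose μ hμ using hF
  obtain ⟨ρ, φ, hφ, hρ⟩ := CompactSpace.tendsto_subseq μ
  refine ⟨ρ, fun s hs => ?_⟩
  have h1 := (ProbabilityMeasure.tendsto_iff_forall_integral_tendsto.mp hρ)
    (BoundedContinuousFunction.mkOfCompact ⟨_, continuous_unitInterval_rpow hs⟩)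
  refine tendsto_nhds_unique h1 ?_
  simpa [Function.comp_def, hμ _ s hs] using (h s hs).comp hφ.tendsto_atTop

/-- The law of a geometric sum has moment function `1 / (1 + c (1 - L))`, which is the fixed point
of the contraction `f ↦ (1 + c L f) / (1 + c)`. -/
theorem IsMomentFunction.geometric {L : ℝ → ℝ} (hL : IsMomentFunction L) {c : ℝ} (hc : 0 ≤ c) :
    IsMomentFunction fun s => (1 + c * (1 - L s))⁻¹ := by
  set q : ℝ := c / (1 + c) with hq
  have hc1 : 0 < 1 + c := by linarith
  have hq0 : 0 ≤ q := by positivity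
  have hq1 : q < 1 := by rw [hq, div_lt_one hc1]; linarith
  let f : ℝ → ℝ := fun s => (1 + c * (1 - L s))⁻¹
  -- Iterates of `g ↦ (1 - q) + q L g` started at `g = 1`. Their distance to the fixed point `f` is
  -- exactly `(q L) ^ k (1 - f)`.
  have key : ∀ k : ℕ, IsMomentFunction fun s => f s + (q * L s) ^ k * (1 - f s) := by
    intro k
    induction k with
    | zero => exact isMomentFunction_congr isMomentFunction_one fun s _ => by simp
    | succ k ih =>
      refine isMomentFunction_congr (isMomentFunction_one.convexComb (hL.mul ih)
        (sub_nonneg.mpr hq1.le) hq0 (by ring)) fun s hs => ?_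
      have h1 := (hL.mem_Icc hs).2
      have h2 : 0 < 1 + c * (1 - L s) := by nlinarith
      have h3 : (1 - q) + q * L s * f s = f s := by
        simp only [f, hq]
        field_simp
        ring
      linear_combination h3
  refine isMomentFunction_of_tendsto key fun s hs => ?_
  have h1 := hL.mem_Icc hs
  have h2 : Tendsto (fun k : ℕ => (q * L s) ^ k) atTop (𝓝 0) :=
    tendsto_pow_atTop_nhds_zero_of_lt_one (mul_nonneg hq0 h1.1) (by nlinarith [h1.1, h1.2])
  simpa using (h2.mul_const (1 - f s)).const_add (f s)

/-- A finite combination of moment functions whose non-negative weights sum to at most one: the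
missing mass is put at `0`. -/
theorem isMomentFunction_sum {F : ℕ → ℝ → ℝ} (hF : ∀ k, IsMomentFunction (F k)) (K : ℕ) :
    ∀ a : ℕ → ℝ, (∀ k, 0 ≤ a k) → ∑ k ∈ Finset.range K, a k ≤ 1 →
      IsMomentFunction fun s => ∑ k ∈ Finset.range K, a k * F k s := by
  induction K with
  | zero => exact fun a _ _ => by simpa using isMomentFunction_zero
  | succ K ih =>
    intro a ha hsum
    rw [Finset.sum_range_succ] at hsum
    have hS : 0 ≤ ∑ k ∈ Finset.range K, a k := Finset.sum_nonneg fun k _ => ha k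
    -- The first `K` weights are rescaled by `1 / (1 - a K)`, so `a K = 1` is treated apart.
    rcases eq_or_lt_of_le (show a K ≤ 1 by linarith) with h1 | h1
    · have h0 : ∀ k ∈ Finset.range K, a k = 0 :=
        (Finset.sum_eq_zero_iff_of_nonneg fun k _ => ha k).mp (by linarith)
      refine isMomentFunction_congr (hF K) fun s _ => ?_
      rw [Finset.sum_range_succ, Finset.sum_eq_zero fun k hk => by rw [h0 k hk, zero_mul], h1]
      ring
    · have h2 : 0 < 1 - a K := by linarith
      have := ih (fun k => a k / (1 - a K)) (fun k => div_nonneg (ha k) h2.le) (by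
        rw [← Finset.sum_div, div_le_one h2]; linarith)
      refine isMomentFunction_congr (this.convexComb (hF K) h2.le (ha K) (by ring)) fun s _ => ?_
      rw [Finset.sum_range_succ, Finset.mul_sum]
      congr 1
      exact Finset.sum_congr rfl fun k _ => by field_simp

theorem choose_succ_mul (α : ℝ) (k : ℕ) :
    Ring.choose α (k + 1) * (k + 1) = Ring.choose α k * (α - k) := by
  have h : ∀ n : ℕ, Ring.choose α n = (n.factorial : ℝ)⁻¹ * (descPochhammer ℝ n).eval α := by
    intro n
    rw [Ring.choose_eq_smul, smul_eq_mul, ← descPochhammer_map (Int.castRingHom ℝ),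
      Polynomial.eval_map, Polynomial.eval₂_eq_sum, Polynomial.smeval_eq_sum]
    congr 2
    funext e a
    simp [Polynomial.smul_pow, zsmul_eq_mul]
  rw [h, h, descPochhammer_succ_eval, Nat.factorial_succ]
  push_cast
  field_simp

/-- Consecutive terms have the ratio `(k + 1 - α) / (k + 2) ≥ 0`. These are the Sibuya weights. -/
theorem alternating_choose_nonneg {α : ℝ} (h0 : 0 ≤ α) (h1 : α ≤ 1) (k : ℕ) :
    0 ≤ (-1) ^ k * Ring.choose α (k + 1) := by
  induction k with
  | zero => simpa using h0
  | succ k ih =>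
    have h2 := choose_succ_mul α (k + 1)
    have h3 : (-1) ^ (k + 1) * Ring.choose α (k + 1 + 1) =
        ((-1) ^ k * Ring.choose α (k + 1)) * ((k + 1 - α) / (k + 2)) := by
      rw [mul_div_assoc', eq_div_iff (by positivity)]
      push_cast at h2
      linear_combination (-1) ^ (k + 1) * h2
    rw [h3]
    exact mul_nonneg ih (div_nonneg (by linarith [k.cast_nonneg (α := ℝ)]) (by positivity))

/-- The binomial series of `(1 - z) ^ α`, with its constant term moved to the other side. -/
theorem hasSum_sibuya (α : ℝ) {z : ℝ} (hz : |z| < 1) :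
    HasSum (fun k : ℕ => (-1) ^ k * Ring.choose α (k + 1) * z ^ (k + 1)) (1 - (1 - z) ^ α) := by
  have h := (Real.one_add_rpow_hasFPowerSeriesOnBall_zero (a := α)).hasSum (y := -z) (by
    simpa [enorm_eq_nnnorm, ← NNReal.coe_lt_coe] using hz)
  have h2 := ((hasSum_nat_add_iff' 1).mpr h).neg
  simp only [binomialSeries_apply, List.ofFn_const, List.prod_replicate, smul_eq_mul,
    Finset.range_one, Finset.sum_singleton, Ring.choose_zero_right, pow_zero, mul_one, neg_sub,
    zero_add, ← sub_eq_add_neg (1 : ℝ) z] at h2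
  convert! h2 using 2 with k
  rw [neg_pow z (k + 1), pow_succ (-1 : ℝ) k]
  ring

/-- The moment function of the Sibuya distribution, pushed forward by `k ↦ e ^ (-k)`. -/
theorem isMomentFunction_sibuya {α : ℝ} (h0 : 0 ≤ α) (h1 : α ≤ 1) {h : ℝ} (hh : 0 < h) :
    IsMomentFunction fun s => 1 - (1 - Real.exp (-(h * s))) ^ α := by
  set a : ℕ → ℝ := fun k => (-1) ^ k * Ring.choose α (k + 1) with ha
  have ha0 : ∀ k, 0 ≤ a k := alternating_choose_nonneg h0 h1
  have hle : ∀ K, ∑ k ∈ Finset.range K, a k ≤ 1 := by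
    intro K
    -- The partial sums are bounded by `1 - (1 - z) ^ α ≤ 1` for `0 < z < 1`; letting `z ↑ 1` bounds
    -- the sum of the weights.
    have h2 : Tendsto (fun z : ℝ => ∑ k ∈ Finset.range K, a k * z ^ (k + 1)) (𝓝[<] 1)
        (𝓝 (∑ k ∈ Finset.range K, a k * 1 ^ (k + 1))) :=
      ((by fun_prop : Continuous fun z : ℝ => ∑ k ∈ Finset.range K, a k * z ^ (k + 1)).tendsto
        1).mono_left nhdsWithin_le_nhds
    simp only [one_pow, mul_one] at h2
    refine le_of_tendsto h2 ?_
    filter_upwards [Ioo_mem_nhdsLT (zero_lt_one' ℝ)] with z hz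
    have h3 := sum_le_hasSum (Finset.range K)
      (fun k _ => mul_nonneg (ha0 k) (pow_nonneg hz.1.le (k + 1)))
      (hasSum_sibuya α (abs_lt.mpr ⟨by linarith [hz.1], hz.2⟩))
    have h4 : 0 ≤ (1 - z) ^ α := Real.rpow_nonneg (by linarith [hz.2]) α
    linarith
  have hF : ∀ k : ℕ, IsMomentFunction fun s => Real.exp (-(h * s)) ^ (k + 1) := by
    intro k
    refine isMomentFunction_congr ((isMomentFunction_rpow ⟨Real.exp (-h), (Real.exp_pos _).le,
      Real.exp_le_one_iff.mpr (by linarith)⟩).pow (k + 1)) fun s _ => ?_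
    rw [← Real.exp_mul, neg_mul]
  refine isMomentFunction_of_tendsto (fun K => isMomentFunction_sum hF K a ha0 (hle K))
    fun s hs => ?_
  refine (hasSum_sibuya α ?_).tendsto_sum_nat
  rw [abs_of_pos (Real.exp_pos _), Real.exp_lt_one_iff]
  nlinarith

/-- The Mittag-Leffler law. -/
theorem isMomentFunction_mittagLeffler {α : ℝ} (h0 : 0 < α) (h1 : α ≤ 1) {c : ℝ} (hc : 0 ≤ c) :
    IsMomentFunction fun s => (1 + c * s ^ α)⁻¹ := by
  have hh : ∀ j : ℕ, (0 : ℝ) < 1 / (j + 1) := fun j => by positivity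
  -- With `h = 1 / (j + 1)`, the constant `c / h ^ α` turns the geometric term into `c ((1 - e ^ (-h
  -- s)) / h) ^ α`, which tends to `c s ^ α`.
  refine isMomentFunction_of_tendsto (fun j : ℕ => (isMomentFunction_sibuya h0.le h1
    (hh j)).geometric (c := c / (1 / ((j : ℝ) + 1)) ^ α)
      (div_nonneg hc (Real.rpow_nonneg (hh j).le α))) fun s hs => ?_
  have h2 : Tendsto (fun h : ℝ => (1 - Real.exp (-(h * s))) / h) (𝓝[≠] 0) (𝓝 s) := by
    have : HasDerivAt (fun h : ℝ => 1 - Real.exp (-(h * s))) s 0 := by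
      have := (((hasDerivAt_id (0 : ℝ)).mul_const s).neg.exp).const_sub 1
      simpa using this
    have := this.tendsto_slope_zero
    simpa [div_eq_inv_mul] using this
  have h3 : Tendsto (fun j : ℕ => 1 / ((j : ℝ) + 1)) atTop (𝓝[≠] 0) :=
    tendsto_nhdsWithin_iff.mpr ⟨tendsto_one_div_add_atTop_nhds_zero_nat,
      Eventually.of_forall fun j => (hh j).ne'⟩
  have h4 := (((h2.comp h3).rpow_const (p := α) (Or.inr h0.le)).const_mul c).const_add 1
  refine (h4.inv₀ (by positivity)).congr fun j => ?_
  have h5 : 0 ≤ 1 - Real.exp (-(1 / ((j : ℝ) + 1) * s)) := by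
    have : 0 < 1 / ((j : ℝ) + 1) * s := mul_pos (hh j) hs
    rw [sub_nonneg, Real.exp_le_one_iff]
    linarith
  simp only [Function.comp]
  rw [Real.div_rpow h5 (hh j).le]
  congr 2
  ring

/-- A moment function that tends to `1` at `0` is the Laplace transform of a law on `ℝ₊`. -/
theorem IsMomentFunction.exists_laplace {f : ℝ → ℝ} (hf : IsMomentFunction f)
    (h1 : Tendsto f (𝓝[>] 0) (𝓝 1)) :
    ∃ ρ : ProbabilityMeasure ℝ≥0, ∀ s : ℝ, 0 < s →
      ∫ x, Real.exp (-(s * x)) ∂(ρ : Measure ℝ≥0) = f s := by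
  obtain ⟨μ, hμ⟩ := hf
  -- An atom at `y = 0` would be mass at `x = ∞`. Since `y ^ s` is at most the indicator of `y ≠ 0`,
  -- the limit `s → 0` excludes it.
  have hne : ∀ᵐ y ∂(μ : Measure I), y ≠ 0 := by
    have h2 : ∀ s : ℝ, 0 < s → f s ≤ (μ : Measure I).real {0}ᶜ := by
      intro s hs
      rw [← hμ s hs, ← integral_indicator_one (measurableSet_singleton _).compl]
      refine integral_mono (integrable_unitInterval_rpow _ hs)
        ((integrable_const (1 : ℝ)).indicator (measurableSet_singleton _).compl) fun y => ?_
      by_cases hy : y = 0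
      · simp [hy, hs.ne']
      · simpa [hy] using Real.rpow_le_one y.2.1 y.2.2 hs.le
    have h3 : 1 ≤ (μ : Measure I).real {0}ᶜ :=
      le_of_tendsto h1 (eventually_nhdsWithin_of_forall fun s hs => h2 s hs)
    rw [probReal_compl_eq_one_sub (measurableSet_singleton _)] at h3
    have h4 : (μ : Measure I).real {0} = 0 := le_antisymm (by linarith) measureReal_nonneg
    rw [measureReal_eq_zero_iff] at h4
    simpa [ae_iff] using h4
  have hm : Measurable fun y : I => Real.toNNReal (-Real.log y) := by fun_prop
  refine ⟨μ.map hm.aemeasurable, fun s hs => ?_⟩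
  rw [ProbabilityMeasure.toMeasure_map, integral_map hm.aemeasurable
    (by fun_prop), ← hμ s hs]
  refine integral_congr_ae (hne.mono fun y hy => ?_)
  have hy0 : (0 : ℝ) < y := lt_of_le_of_ne y.2.1 fun h => hy (Subtype.ext h.symm)
  have hlog : 0 ≤ -Real.log y := neg_nonneg.mpr (Real.log_nonpos y.2.1 y.2.2)
  simp only [Real.coe_toNNReal _ hlog]
  rw [Real.rpow_def_of_pos hy0]
  congr 1
  ring

/-- The `m`-fold convolution of Mittag-Leffler laws of scale `m ^ (-1 / α)`. -/
theorem exists_erlang_mittagLeffler {α : ℝ} (h0 : 0 < α) (h1 : α ≤ 1) (m : ℕ) :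
    ∃ ρ : ProbabilityMeasure ℝ≥0, ∀ s : ℝ, 0 ≤ s →
      ∫ x, Real.exp (-(s * x)) ∂(ρ : Measure ℝ≥0) = ((1 + s ^ α / m) ^ m)⁻¹ := by
  have h2 := (isMomentFunction_mittagLeffler h0 h1 (inv_nonneg.mpr m.cast_nonneg)).pow m
  obtain ⟨ρ, hρ⟩ := h2.exists_laplace (by
    have h3 : Continuous fun s : ℝ => s ^ α := Real.continuous_rpow_const h0.le
    have h4 : ContinuousAt (fun s : ℝ => (1 + (m : ℝ)⁻¹ * s ^ α)⁻¹ ^ m) 0 := by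
      refine ContinuousAt.pow (ContinuousAt.inv₀ (by fun_prop) ?_) m
      simp [h0.ne']
    have h5 := h4.tendsto
    simp only [Real.zero_rpow h0.ne', mul_zero, add_zero, inv_one, one_pow] at h5
    exact h5.mono_left nhdsWithin_le_nhds)
  refine ⟨ρ, fun s hs => ?_⟩
  rcases hs.eq_or_lt with rfl | hs
  · simp [h0.ne']
  · rw [hρ s hs, inv_pow, div_eq_inv_mul]

end Moments

/-! ### Phase-type representation of finite mixtures of scaled Erlang-type laws -/

open Filter Topology

/-- Membership in `MPH*_α` for a phase-type structure on an arbitrary finite set of states, with the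
Laplace transform expressed by the solution of the linear system. -/
theorem mem_MPHStar_of_fintype {ι : Type*} [Fintype ι] {n : ℕ} {α : ℝ}
    (π : ι → ℝ) (T : Matrix ι ι ℝ) (R : Matrix ι (Fin n) ℝ)
    (μ : ProbabilityMeasure (Fin n → ℝ≥0)) (hπ : ∀ i, 0 ≤ π i) (hπ1 : ∑ i, π i = 1)
    (hT : ∀ i j, i ≠ j → 0 ≤ T i j) (hexit : ∀ i, ∑ j, T i j ≤ 0)
    (htrans : ∀ i, ∃ j, Relation.ReflTransGen (fun a b => 0 < T a b) i j ∧ ∑ l, T j l < 0)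
    (hR : ∀ i k, 0 ≤ R i k)
    (hlaw : ∀ θ : Fin n → ℝ≥0, ∃ v : ι → ℝ,
      (∀ i, (∑ k, R i k * (θ k : ℝ)) ^ α * v i - ∑ j, T i j * v j = -∑ j, T i j) ∧
      ∫ y, Real.exp (-∑ k, (y k : ℝ) * (θ k : ℝ)) ∂(μ : Measure (Fin n → ℝ≥0)) =
        ∑ i, π i * v i) :
    μ ∈ MPHStar n α := by
  classical
  let e := Fintype.equivFin ι
  have hrow : ∀ i, exitRate (T.submatrix e.symm e.symm) i = -∑ j, T (e.symm i) j := fun i => by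
    simp only [exitRate, Matrix.submatrix_apply]
    rw [e.symm.sum_comp (fun j => T (e.symm i) j)]
  have hsub : IsSubIntensity (T.submatrix e.symm e.symm) := by
    refine ⟨fun i j hij => hT _ _ (e.symm.injective.ne hij), fun i => ?_, fun i => ?_⟩
    · rw [hrow]
      linarith [hexit (e.symm i)]
    · obtain ⟨j, hj, hj2⟩ := htrans (e.symm i)
      refine ⟨e j, ?_, ?_⟩
      · have := hj.lift (p := fun a b => 0 < T.submatrix e.symm e.symm a b) e
          (fun a b h => by simpa [Function.onFun] using h)
        simpa [Function.onFun] using this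
      · rw [hrow]
        simpa using hj2
  refine ⟨Fintype.card ι, π ∘ e.symm, T.submatrix e.symm e.symm, fun i k => R (e.symm i) k,
    ⟨fun i => hπ _, ?_⟩, hsub, fun i k => hR _ k, fun θ => ?_⟩
  · simpa using (e.symm.sum_comp π).trans hπ1
  obtain ⟨v, hv, hint⟩ := hlaw θ
  have hunit := isUnit_det_rewardDiag_sub α hsub (R := fun i k => R (e.symm i) k)
    (fun i k => hR _ k) θ
  have hsol : (rewardDiag α (fun i k => R (e.symm i) k) θ - T.submatrix e.symm e.symm) *ᵥ
      (v ∘ e.symm) = exitRate (T.submatrix e.symm e.symm) := by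
    funext i
    simp only [Matrix.sub_mulVec, Pi.sub_apply, rewardDiag, Matrix.mulVec_diagonal]
    rw [hrow, ← hv (e.symm i)]
    congr 1
    exact e.symm.sum_comp (fun j => T (e.symm i) j * v j)
  rw [← hsol, Matrix.mulVec_mulVec, Matrix.nonsing_inv_mul _ hunit, Matrix.one_mulVec, hint]
  exact (e.symm.sum_comp (fun i => π i * v i)).symm

/-- Parallel blocks indexed by `J`, each a chain of stages of rate `r`. The stage is the number of
stages that remain after it. -/
noncomputable def erlangBlocks (J : Type*) [DecidableEq J] (m : ℕ) (r : ℝ) :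
    Matrix (J × Fin m) (J × Fin m) ℝ :=
  fun a b => if a.1 = b.1 then
    (if b.2 = a.2 then -r else 0) + (if (b.2 : ℕ) + 1 = a.2 then r else 0) else 0

/-- Each row has at most two nonzero entries: stage `i` stays in its block and moves to `i - 1`,
while stage `0` exits. -/
theorem erlangBlocks_sum_mul {J : Type*} [Fintype J] [DecidableEq J] {m : ℕ} (r : ℝ)
    (u : J → ℕ → ℝ) (a : J × Fin m) :
    ∑ b, erlangBlocks J m r a b * u b.1 b.2 =
      -r * u a.1 a.2 + if (a.2 : ℕ) = 0 then 0 else r * u a.1 (a.2 - 1) := by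
  obtain ⟨j, i⟩ := a
  simp only [erlangBlocks, Fintype.sum_prod_type, ite_mul, zero_mul]
  rw [Finset.sum_eq_single j (fun b _ hb => by simp [hb.symm]) (by simp)]
  simp only [if_true, add_mul, ite_mul, zero_mul, Finset.sum_add_distrib, Finset.sum_ite_eq',
    Finset.mem_univ]
  congr 1
  by_cases hi : (i : ℕ) = 0
  · simp [hi]
  · rw [if_neg hi, Finset.sum_eq_single (⟨i - 1, by omega⟩ : Fin m)]
    · rw [if_pos (by simp only []; omega)]
    · intro b _ hb
      rw [if_neg fun h => hb (Fin.ext (by simp only []; omega))]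
    · simp

theorem erlangBlocks_row_sum {J : Type*} [Fintype J] [DecidableEq J] {m : ℕ} (r : ℝ)
    (a : J × Fin m) :
    ∑ b, erlangBlocks J m r a b = if (a.2 : ℕ) = 0 then -r else 0 := by
  have h := erlangBlocks_sum_mul r (fun _ _ => 1) a
  simp only [mul_one] at h
  rw [h]
  split_ifs <;> ring

theorem erlangBlocks_nonneg {J : Type*} [DecidableEq J] {m : ℕ} {r : ℝ} (hr : 0 ≤ r)
    (a b : J × Fin m) (hab : a ≠ b) : 0 ≤ erlangBlocks J m r a b := by
  unfold erlangBlocks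
  split_ifs with h1 h2 h3 h3
  · exact absurd (Prod.ext h1 h2.symm) hab
  · exact absurd (Prod.ext h1 h2.symm) hab
  all_goals simp [hr]

theorem erlangBlocks_reach {J : Type*} [DecidableEq J] {m : ℕ} {r : ℝ} (hr : 0 < r) (j : J) :
    ∀ (i : ℕ) (hi : i < m), Relation.ReflTransGen (fun a b => 0 < erlangBlocks J m r a b)
      (j, ⟨i, hi⟩) (j, ⟨0, by omega⟩) := by
  intro i
  induction i with
  | zero => exact fun hi => Relation.ReflTransGen.refl
  | succ i ih =>
    intro hi
    refine Relation.ReflTransGen.head ?_ (ih (by omega))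
    simp [erlangBlocks, hr]

theorem integral_comp_simpleFunc {Ω E : Type*} [MeasurableSpace Ω] (μ : Measure Ω)
    [IsFiniteMeasure μ] (G : SimpleFunc Ω E) (Φ : E → ℝ) :
    ∫ x, Φ (G x) ∂μ = ∑ b : G.range, μ.real (G ⁻¹' {(b : E)}) * Φ b := by
  classical
  have h : ∀ x, Φ (G x) = ∑ b : G.range, (G ⁻¹' {(b : E)}).indicator (fun _ => Φ b) x := by
    intro x
    rw [Finset.sum_eq_single ⟨G x, G.mem_range_self x⟩]
    · simp
    · intro b _ hb
      refine Set.indicator_of_notMem (fun hx => hb ?_) _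
      exact Subtype.ext hx.symm
    · simp
  simp only [h]
  rw [integral_finsetSum _ fun b _ =>
    (integrable_const _).indicator (G.measurableSet_fiber _)]
  refine Finset.sum_congr rfl fun b _ => ?_
  rw [integral_indicator_const _ (G.measurableSet_fiber _), smul_eq_mul]

theorem measurable_simpleFunc_mul {Ω : Type*} [MeasurableSpace Ω] {n : ℕ}
    (G : SimpleFunc Ω (Fin n → ℝ≥0)) :
    Measurable fun z : Ω × ℝ≥0 => fun k => G z.1 k * z.2 :=
  measurable_pi_lambda _ fun k =>
    ((measurable_pi_apply k).comp (G.measurable.comp measurable_fst)).mul measurable_snd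

/-- The law of `G · S` for a random vector `G` with finitely many values and an independent sum `S`
of Mittag-Leffler variables. -/
theorem map_simpleFunc_mul_mem_MPHStar {Ω : Type*} [MeasurableSpace Ω] {n : ℕ} {α : ℝ}
    (μ : ProbabilityMeasure Ω) (G : SimpleFunc Ω (Fin n → ℝ≥0)) (m : ℕ)
    (σ : ProbabilityMeasure ℝ≥0)
    (hσ : ∀ s : ℝ, 0 ≤ s → ∫ x, Real.exp (-(s * x)) ∂(σ : Measure ℝ≥0) =
      ((1 + s ^ α / ((m + 1 : ℕ) : ℝ)) ^ (m + 1))⁻¹) :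
    (μ.prod σ).map (measurable_simpleFunc_mul G).aemeasurable ∈ MPHStar n α := by
  classical
  have hr : (0 : ℝ) < ((m + 1 : ℕ) : ℝ) := by positivity
  set r : ℝ := ((m + 1 : ℕ) : ℝ) with hrdef
  -- Block `b` is entered with probability `P(G = b)`, at the last index, so all `m + 1` stages are
  -- traversed.
  refine mem_MPHStar_of_fintype (ι := G.range × Fin (m + 1))
    (fun a => if a.2 = Fin.last m then (μ : Measure Ω).real (G ⁻¹' {(a.1 : Fin n → ℝ≥0)}) else 0)
    (erlangBlocks G.range (m + 1) r) (fun a k => ((a.1 : Fin n → ℝ≥0) k : ℝ)) _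
    (fun a => by split_ifs <;> simp) ?_ (erlangBlocks_nonneg hr.le) (fun a => ?_) (fun a => ?_)
    (fun a k => NNReal.coe_nonneg _) (fun θ => ?_)
  · have h := integral_comp_simpleFunc (μ : Measure Ω) G (fun _ => 1)
    simp only [Fintype.sum_prod_type, Finset.sum_ite_eq', Finset.mem_univ, if_true]
    simpa using h.symm
  · rw [erlangBlocks_row_sum]
    split_ifs <;> linarith
  · refine ⟨_, erlangBlocks_reach hr a.1 a.2 a.2.2, ?_⟩
    rw [erlangBlocks_row_sum]
    simpa using hr
  · let d : (Fin n → ℝ≥0) → ℝ := fun b => ∑ k, (b k : ℝ) * (θ k : ℝ)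
    have hd : ∀ b, 0 ≤ d b := fun b =>
      Finset.sum_nonneg fun k _ => mul_nonneg (b k).2 (θ k).2
    have hdα : ∀ b, 0 ≤ d b ^ α := fun b => Real.rpow_nonneg (hd b) α
    let q : (Fin n → ℝ≥0) → ℝ := fun b => (1 + d b ^ α / r)⁻¹
    have hq : ∀ b, (r + d b ^ α) * q b = r := fun b => by
      have := hdα b
      simp only [q]
      field_simp
    -- Each stage contributes a factor `q`; at index `i` there are `i + 1` stages left, including
    -- the current one.
    refine ⟨fun a => q a.1 ^ ((a.2 : ℕ) + 1), fun a => ?_, ?_⟩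
    · rw [erlangBlocks_sum_mul r (fun (j : G.range) i => q j ^ (i + 1)) a, erlangBlocks_row_sum]
      have hqa := hq a.1
      change d a.1 ^ α * q a.1 ^ ((a.2 : ℕ) + 1) - _ = _
      split_ifs with h0
      · rw [h0]
        linear_combination hqa
      · obtain ⟨l, hl⟩ := Nat.exists_eq_succ_of_ne_zero h0
        rw [hl]
        simp only [Nat.succ_eq_add_one, Nat.add_sub_cancel]
        linear_combination q a.1 ^ (l + 1) * hqa
    · rw [ProbabilityMeasure.toMeasure_map,
        integral_map (measurable_simpleFunc_mul G).aemeasurable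
          (Measurable.aestronglyMeasurable (by fun_prop))]
      have h1 : ∀ z : Ω × ℝ≥0, Real.exp (-∑ k, ((G z.1 k * z.2 : ℝ≥0) : ℝ) * (θ k : ℝ)) =
          Real.exp (-(d (G z.1) * z.2)) := fun z => by
        congr 2
        rw [Finset.sum_mul]
        exact Finset.sum_congr rfl fun k _ => by push_cast; ring
      have hmeas : Measurable fun z : Ω × ℝ≥0 => Real.exp (-(d (G z.1) * z.2)) := by
        have : Measurable fun x => d (G x) := (by fun_prop : Measurable d).comp G.measurable
        fun_prop
      simp only [h1]
      rw [ProbabilityMeasure.toMeasure_prod, integral_prod]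
      · simp only [hσ _ (hd _)]
        rw [integral_comp_simpleFunc (μ : Measure Ω) G
          (fun b => ((1 + d b ^ α / r) ^ (m + 1))⁻¹)]
        simp [Fintype.sum_prod_type, q, inv_pow]
      · refine Integrable.of_bound hmeas.aestronglyMeasurable 1 (ae_of_all _ fun z => ?_)
        rw [Real.norm_of_nonneg (Real.exp_pos _).le, Real.exp_le_one_iff, neg_nonpos]
        exact mul_nonneg (hd _) z.2.2

/-! ### Multiplicative factors degenerating to `1`, and density -/

theorem measurable_mul_rpow {Ω : Type*} [MeasurableSpace Ω] {n : ℕ}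
    {F : Ω → Fin n → ℝ≥0} (hF : Measurable F) (γ : Fin n → ℝ) :
    Measurable fun z : Ω × ℝ≥0 => fun k => F z.1 k * z.2 ^ γ k :=
  measurable_pi_lambda _ fun k =>
    ((measurable_pi_apply k).comp (hF.comp measurable_fst)).mul (measurable_snd.pow_const _)

theorem measurable_const_mul_rpow {n : ℕ} (γ : Fin n → ℝ) (c : Fin n → ℝ≥0) :
    Measurable fun x : ℝ≥0 => fun k => c k * x ^ γ k :=
  measurable_pi_lambda _ fun _ => (measurable_id.pow_const _).const_mul _

/-- The factors `σ j` with exponents `γ j` degenerate to `1`, uniformly enough to be multiplied with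
any fixed vector. -/
def TendstoOne {n : ℕ} (σ : ℕ → ProbabilityMeasure ℝ≥0) (γ : ℕ → Fin n → ℝ) : Prop :=
  ∀ (h : BoundedContinuousFunction (Fin n → ℝ≥0) ℝ) (b : Fin n → ℝ≥0),
    Tendsto (fun j => ∫ x, h (fun k => b k * x ^ γ j k) ∂(σ j : Measure ℝ≥0)) atTop (𝓝 (h b))

theorem TendstoOne.tendsto_map {Ω : Type*} [MeasurableSpace Ω] {n : ℕ}
    {σ : ℕ → ProbabilityMeasure ℝ≥0} {γ : ℕ → Fin n → ℝ} (H : TendstoOne σ γ)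
    (μ : ProbabilityMeasure Ω) {F : Ω → Fin n → ℝ≥0} (hF : Measurable F) :
    Tendsto (fun j => (μ.prod (σ j)).map (measurable_mul_rpow hF (γ j)).aemeasurable) atTop
      (𝓝 (μ.map hF.aemeasurable)) := by
  rw [ProbabilityMeasure.tendsto_iff_forall_integral_tendsto]
  intro h
  have hh : Measurable h := h.continuous.measurable
  simp only [ProbabilityMeasure.toMeasure_map]
  rw [integral_map hF.aemeasurable h.continuous.aestronglyMeasurable]
  have h1 : ∀ j, ∫ y, h y ∂((μ.prod (σ j) : Measure (Ω × ℝ≥0)).map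
      (fun z : Ω × ℝ≥0 => fun k => F z.1 k * z.2 ^ γ j k)) =
      ∫ x, ∫ s, h (fun k => F x k * s ^ γ j k) ∂(σ j : Measure ℝ≥0) ∂(μ : Measure Ω) := fun j => by
    rw [integral_map (measurable_mul_rpow hF (γ j)).aemeasurable
      h.continuous.aestronglyMeasurable, ProbabilityMeasure.toMeasure_prod, integral_prod]
    exact Integrable.of_bound (hh.comp (measurable_mul_rpow hF (γ j))).aestronglyMeasurable ‖h‖
      (ae_of_all _ fun z => h.norm_coe_le_norm _)
  simp only [h1]
  refine tendsto_integral_of_dominated_convergence (fun _ => ‖h‖) (fun j => ?_)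
    (integrable_const _) (fun j => ae_of_all _ fun x => ?_) (ae_of_all _ fun x => H h (F x))
  · have h2 : StronglyMeasurable (Function.uncurry fun x s => h (fun k => F x k * s ^ γ j k)) :=
      (hh.comp (measurable_mul_rpow hF (γ j))).stronglyMeasurable
    exact (h2.integral_prod_right (ν := (σ j : Measure ℝ≥0))).aestronglyMeasurable
  · simpa using norm_integral_le_of_norm_le_const (μ := (σ j : Measure ℝ≥0))
      (ae_of_all _ fun s => h.norm_coe_le_norm (fun k => F x k * s ^ γ j k))

/-- The laws of simple functions with positive values are dense. -/
theorem dense_of_simpleFunc_mem_closure {n : ℕ} {S : Set (ProbabilityMeasure (Fin n → ℝ≥0))}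
    (hS : ∀ (μ : ProbabilityMeasure (Fin n → ℝ≥0)) (F : SimpleFunc (Fin n → ℝ≥0) (Fin n → ℝ≥0)),
      (∀ x k, 0 < F x k) → μ.map F.measurable.aemeasurable ∈ closure S) : Dense S := by
  intro μ
  rw [← closure_closure]
  -- Strictly positive vectors are dense, so the approximating simple functions can avoid zero
  -- coordinates; this keeps the marginals in (iii) nondegenerate.
  let P : Set (Fin n → ℝ≥0) := {b | ∀ k, 0 < b k}
  have hP : closure P = Set.univ := by
    have : P = Set.univ.pi fun _ => Set.Ioi 0 := by
      ext b
      simp [P]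
    rw [this, closure_pi_set]
    simp [closure_Ioi]
  let F := SimpleFunc.approxOn (id : (Fin n → ℝ≥0) → Fin n → ℝ≥0) measurable_id P (fun _ => 1)
    (fun _ => one_pos)
  refine mem_closure_of_tendsto (f := fun j => μ.map (F j).measurable.aemeasurable) (b := atTop) ?_
    (Eventually.of_forall fun j => hS μ (F j) fun x k =>
      (show F j x ∈ P from SimpleFunc.approxOn_mem _ _ j x) k)
  rw [ProbabilityMeasure.tendsto_iff_forall_integral_tendsto]
  intro h
  simp only [ProbabilityMeasure.toMeasure_map]
  simp_rw [integral_map (F _).measurable.aemeasurable h.continuous.aestronglyMeasurable]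
  refine tendsto_integral_of_dominated_convergence (fun _ => ‖h‖) (fun j => ?_)
    (integrable_const _) (fun j => ae_of_all _ fun x => h.norm_coe_le_norm _)
    (ae_of_all _ fun x => ?_)
  · exact (h.continuous.measurable.comp (F j).measurable).aestronglyMeasurable
  · exact (h.continuous.tendsto x).comp
      (SimpleFunc.tendsto_approxOn measurable_id (s := P) (y₀ := fun _ => 1) (fun _ => one_pos)
        (by rw [hP]; trivial))

theorem TendstoOne.dense {n : ℕ} {σ : ℕ → ProbabilityMeasure ℝ≥0} {γ : ℕ → Fin n → ℝ}
    (H : TendstoOne σ γ) {S : Set (ProbabilityMeasure (Fin n → ℝ≥0))}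
    (hS : ∀ (μ : ProbabilityMeasure (Fin n → ℝ≥0)) (F : SimpleFunc (Fin n → ℝ≥0) (Fin n → ℝ≥0)),
      (∀ x k, 0 < F x k) → ∀ j,
        (μ.prod (σ j)).map (measurable_mul_rpow F.measurable (γ j)).aemeasurable ∈ S) :
    Dense S :=
  dense_of_simpleFunc_mem_closure fun μ F hF =>
    mem_closure_of_tendsto (H.tendsto_map μ F.measurable) (Eventually.of_forall (hS μ F hF))

/-- For `x > 0`, `x ^ γ → 1` as `γ → 0`; this fails at `x = 0`, hence the condition on the atom. -/
theorem tendstoOne_const {n : ℕ} {σ : ProbabilityMeasure ℝ≥0} (h0 : (σ : Measure ℝ≥0) {0} = 0)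
    {γ : ℕ → Fin n → ℝ} (hγ : Tendsto γ atTop (𝓝 0)) : TendstoOne (fun _ => σ) γ := by
  intro h b
  have h1 : ∫ _, h b ∂(σ : Measure ℝ≥0) = h b := by simp
  rw [← h1]
  refine tendsto_integral_of_dominated_convergence (fun _ => ‖h‖) (fun j => ?_)
    (integrable_const _) (fun j => ae_of_all _ fun x => h.norm_coe_le_norm _) ?_
  · exact (h.continuous.measurable.comp
      (measurable_const_mul_rpow (γ j) b)).aestronglyMeasurable
  · have hne : ∀ᵐ x ∂(σ : Measure ℝ≥0), x ≠ 0 := by simpa [ae_iff] using h0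
    filter_upwards [hne] with x hx
    refine (h.continuous.tendsto b).comp (tendsto_pi_nhds.mpr fun k => ?_)
    have h2 : Tendsto (fun j => x ^ γ j k) atTop (𝓝 (x ^ (0 : ℝ))) :=
      ((NNReal.continuousAt_rpow (x := x) (y := 0) (Or.inl hx)).tendsto).comp
        (tendsto_const_nhds.prodMk_nhds (tendsto_pi_nhds.mp hγ k))
    simpa using h2.const_mul (b k)

/-- Convergence of the Laplace transform to `e ^ (-s)` at `s = 1, 2` gives convergence to `1` in
probability, by Chebyshev's inequality for `e ^ (-X)`. -/
theorem tendstoOne_of_laplace {n : ℕ} {σ : ℕ → ProbabilityMeasure ℝ≥0}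
    (h1 : Tendsto (fun j => ∫ x, Real.exp (-(1 * x)) ∂(σ j : Measure ℝ≥0)) atTop
      (𝓝 (Real.exp 1)⁻¹))
    (h2 : Tendsto (fun j => ∫ x, Real.exp (-(2 * x)) ∂(σ j : Measure ℝ≥0)) atTop
      (𝓝 (Real.exp 2)⁻¹))
    {γ : ℕ → Fin n → ℝ} {γ₀ : Fin n → ℝ} (hγ : Tendsto γ atTop (𝓝 γ₀)) : TendstoOne σ γ := by
  intro h b
  obtain ⟨e, he⟩ : ∃ e : ℝ, e = (Real.exp 1)⁻¹ := ⟨_, rfl⟩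
  rw [← he] at h1
  have hexp : ∀ (s : ℝ), 0 ≤ s → ∀ j, Integrable (fun x : ℝ≥0 => Real.exp (-(s * x)))
      (σ j : Measure ℝ≥0) := fun s hs j => by
    refine Integrable.of_bound (by fun_prop) 1 (ae_of_all _ fun x => ?_)
    rw [Real.norm_of_nonneg (Real.exp_pos _).le, Real.exp_le_one_iff, neg_nonpos]
    exact mul_nonneg hs x.2
  have hsq : ∀ x : ℝ≥0, (Real.exp (-(1 * x)) - e) ^ 2 =
      Real.exp (-(2 * x)) - 2 * e * Real.exp (-(1 * x)) + e ^ 2 := fun x => by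
    rw [show -(2 * (x : ℝ)) = -(1 * x) + -(1 * x) by ring, Real.exp_add]
    ring
  have hsqi : ∀ j, Integrable (fun x : ℝ≥0 => (Real.exp (-(1 * x)) - e) ^ 2)
      (σ j : Measure ℝ≥0) := fun j => by
    simp only [hsq]
    exact ((hexp 2 zero_le_two j).sub ((hexp 1 zero_le_one j).const_mul _)).add
      (integrable_const _)
  -- The second moment of `e ^ (-X)` about `e = e ^ (-1)` tends to `e ^ (-2) - 2 e · e + e ^ 2 = 0`.
  have hV : Tendsto (fun j => ∫ x : ℝ≥0, (Real.exp (-(1 * x)) - e) ^ 2 ∂(σ j : Measure ℝ≥0))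
      atTop (𝓝 0) := by
    have h3 : ∀ j, ∫ x : ℝ≥0, (Real.exp (-(1 * x)) - e) ^ 2 ∂(σ j : Measure ℝ≥0) =
        ∫ x, Real.exp (-(2 * x)) ∂(σ j : Measure ℝ≥0) -
          2 * e * ∫ x, Real.exp (-(1 * x)) ∂(σ j : Measure ℝ≥0) + e ^ 2 := fun j => by
      have h4 := (hexp 1 zero_le_one j).const_mul (2 * e)
      have h5 : Integrable (fun x : ℝ≥0 => Real.exp (-(2 * x)) - 2 * e * Real.exp (-(1 * x)))
        (σ j : Measure ℝ≥0) := (hexp 2 zero_le_two j).sub h4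
      simp only [hsq]
      rw [integral_add h5 (integrable_const _), integral_sub (hexp 2 zero_le_two j) h4,
        integral_const_mul]
      simp
    simp only [h3]
    have h4 := (h2.sub (h1.const_mul (2 * e))).add_const (e ^ 2)
    rwa [show (Real.exp 2)⁻¹ - 2 * e * e + e ^ 2 = 0 by
      rw [he, show (2 : ℝ) = 1 + 1 by norm_num, Real.exp_add]
      field_simp
      ring] at h4
  rw [Metric.tendsto_nhds]
  intro ε hε
  -- The integrand in the variables `y = e ^ (-x)` and exponent, so that joint continuity at `(e,
  -- γ₀)` handles both limits at once.
  let Ψ : ℝ × (Fin n → ℝ) → ℝ := fun p =>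
    h (fun k => b k * Real.toNNReal (-Real.log p.1) ^ p.2 k)
  have he0 : e ≠ 0 := he ▸ inv_ne_zero (Real.exp_ne_zero 1)
  have hlog : Real.toNNReal (-Real.log e) = 1 := by simp [he]
  have hΨ : ContinuousAt Ψ (e, γ₀) := by
    refine h.continuous.continuousAt.comp (continuousAt_pi.mpr fun k => ?_)
    refine continuousAt_const.mul ?_
    have h3 : ContinuousAt (fun p : ℝ × (Fin n → ℝ) => Real.toNNReal (-Real.log p.1))
        (e, γ₀) :=
      continuous_real_toNNReal.continuousAt.comp
        (f := fun p : ℝ × (Fin n → ℝ) => -Real.log p.1) (continuousAt_fst.log he0).neg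
    have h4 : ContinuousAt (fun p : ℝ × (Fin n → ℝ) => p.2 k) (e, γ₀) := by fun_prop
    exact ContinuousAt.comp (f := fun p : ℝ × (Fin n → ℝ) =>
        (Real.toNNReal (-Real.log p.1), p.2 k)) (g := fun q : ℝ≥0 × ℝ => q.1 ^ q.2)
      (NNReal.continuousAt_rpow (Or.inl (by simp [hlog]))) (h3.prodMk h4)
  have hΨe : Ψ (e, γ₀) = h b := by simp [Ψ, hlog]
  have hev := Metric.tendsto_nhds.mp hΨ.tendsto (ε / 2) (half_pos hε)
  rw [nhds_prod_eq, eventually_prod_iff] at hev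
  obtain ⟨pa, hpa, pb, hpb, hab⟩ := hev
  obtain ⟨δ, hδ, hpa⟩ := Metric.eventually_nhds_iff.mp hpa
  have hC : 0 ≤ 2 * ‖h‖ / δ ^ 2 := by positivity
  have hV2 := (hV.const_mul (2 * ‖h‖ / δ ^ 2)).eventually_lt_const
    (show 2 * ‖h‖ / δ ^ 2 * 0 < ε / 2 by simpa using half_pos hε)
  filter_upwards [hγ.eventually hpb, hV2] with j hj hVj
  -- Continuity of `Ψ` gives `ε / 2` when `e ^ (-x)` is within `δ` of `e`; otherwise the quadratic
  -- term already exceeds the trivial bound `2 ‖h‖`.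
  have hpt : ∀ x : ℝ≥0, ‖h (fun k => b k * x ^ γ j k) - h b‖ ≤
      ε / 2 + 2 * ‖h‖ / δ ^ 2 * (Real.exp (-(1 * x)) - e) ^ 2 := by
    intro x
    by_cases hx : |Real.exp (-(1 * x)) - e| < δ
    · have h3 := hab (hpa (by rwa [Real.dist_eq])) hj
      rw [hΨe] at h3
      simp only [Ψ, Real.log_exp, neg_neg, one_mul, Real.toNNReal_coe, Real.dist_eq] at h3
      rw [Real.norm_eq_abs]
      have : 0 ≤ 2 * ‖h‖ / δ ^ 2 * (Real.exp (-(1 * x)) - e) ^ 2 := by positivity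
      linarith
    · have h3 : δ ^ 2 ≤ (Real.exp (-(1 * x)) - e) ^ 2 := by
        rw [← sq_abs (_ - _)]
        exact pow_le_pow_left₀ hδ.le (not_lt.mp hx) 2
      have h4 : 2 * ‖h‖ ≤ 2 * ‖h‖ / δ ^ 2 * (Real.exp (-(1 * x)) - e) ^ 2 := by
        rw [div_mul_eq_mul_div, le_div_iff₀ (by positivity)]
        gcongr
      have h5 := norm_sub_le (h (fun k => b k * x ^ γ j k)) (h b)
      have h6 := h.norm_coe_le_norm (fun k => b k * x ^ γ j k)
      have h7 := h.norm_coe_le_norm b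
      linarith
  have hint : Integrable (fun x : ℝ≥0 => h (fun k => b k * x ^ γ j k)) (σ j : Measure ℝ≥0) :=
    Integrable.of_bound (h.continuous.measurable.comp
      (measurable_const_mul_rpow (γ j) b)).aestronglyMeasurable ‖h‖
      (ae_of_all _ fun x => h.norm_coe_le_norm _)
  rw [Real.dist_eq, ← Real.norm_eq_abs]
  calc ‖∫ x, h (fun k => b k * x ^ γ j k) ∂(σ j : Measure ℝ≥0) - h b‖
      = ‖∫ x, (h (fun k => b k * x ^ γ j k) - h b) ∂(σ j : Measure ℝ≥0)‖ := by
        rw [integral_sub hint (integrable_const _)]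
        simp
    _ ≤ ∫ x : ℝ≥0, (ε / 2 + 2 * ‖h‖ / δ ^ 2 * (Real.exp (-(1 * x)) - e) ^ 2)
          ∂(σ j : Measure ℝ≥0) :=
        norm_integral_le_of_norm_le ((integrable_const _).add ((hsqi j).const_mul _))
          (ae_of_all _ hpt)
    _ = ε / 2 + 2 * ‖h‖ / δ ^ 2 *
          ∫ x : ℝ≥0, (Real.exp (-(1 * x)) - e) ^ 2 ∂(σ j : Measure ℝ≥0) := by
        rw [integral_add (integrable_const _) ((hsqi j).const_mul _), integral_const_mul]
        simp
    _ < ε := by linarith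

/-- The atom at `0` is bounded by the Laplace transform at every `s`, which vanishes as `s → ∞`. -/
theorem measure_singleton_zero_of_laplace {α : ℝ} (hα : 0 < α) {m : ℕ}
    {σ : ProbabilityMeasure ℝ≥0}
    (hσ : ∀ s : ℝ, 0 ≤ s → ∫ x, Real.exp (-(s * x)) ∂(σ : Measure ℝ≥0) =
      ((1 + s ^ α / ((m + 1 : ℕ) : ℝ)) ^ (m + 1))⁻¹) :
    (σ : Measure ℝ≥0) {0} = 0 := by
  have h1 : ∀ s : ℝ, 0 ≤ s → (σ : Measure ℝ≥0).real {0} ≤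
      ((1 + s ^ α / ((m + 1 : ℕ) : ℝ)) ^ (m + 1))⁻¹ := by
    intro s hs
    rw [← hσ s hs, ← integral_indicator_one (measurableSet_singleton _)]
    refine integral_mono ((integrable_const (1 : ℝ)).indicator (measurableSet_singleton _))
      (Integrable.of_bound (by fun_prop) 1 (ae_of_all _ fun x => ?_)) fun x => ?_
    · rw [Real.norm_of_nonneg (Real.exp_pos _).le, Real.exp_le_one_iff, neg_nonpos]
      exact mul_nonneg hs x.2
    · by_cases hx : x = 0
      · simp [hx]
      · simpa [hx] using (Real.exp_pos _).le
  have h2 : Tendsto (fun s : ℝ => ((1 + s ^ α / ((m + 1 : ℕ) : ℝ)) ^ (m + 1))⁻¹) atTop (𝓝 0) :=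
    tendsto_inv_atTop_zero.comp ((tendsto_pow_atTop (Nat.succ_ne_zero m)).comp
      (tendsto_atTop_add_const_left _ _
        ((tendsto_rpow_atTop hα).atTop_div_const (by positivity))))
  have h3 : (σ : Measure ℝ≥0).real {0} ≤ 0 :=
    ge_of_tendsto h2 ((eventually_ge_atTop 0).mono fun s hs => h1 s hs)
  exact (measureReal_eq_zero_iff (by finiteness)).mp (le_antisymm h3 measureReal_nonneg)

/-- A sequence of sums of Mittag-Leffler variables whose index tends to `1` and which converges to
`1`. -/
theorem exists_tendstoOne_erlang :
    ∃ (α : ℕ → ℝ) (σ : ℕ → ProbabilityMeasure ℝ≥0), (∀ j, 0 < α j ∧ α j < 1) ∧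
      Tendsto α atTop (𝓝 1) ∧
      (∀ j, ∀ s : ℝ, 0 ≤ s → ∫ x, Real.exp (-(s * x)) ∂(σ j : Measure ℝ≥0) =
        ((1 + s ^ α j / ((j + 1 : ℕ) : ℝ)) ^ (j + 1))⁻¹) ∧
      ∀ (n : ℕ) (γ : ℕ → Fin n → ℝ) (γ₀ : Fin n → ℝ), Tendsto γ atTop (𝓝 γ₀) →
        TendstoOne σ γ := by
  -- Any indices in `(0, 1)` tending to `1` would do. Since `a 0 = 0`, everything is shifted to `j +
  -- 1`.
  let a : ℕ → ℝ := fun m => m / (m + 1)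
  have ha : Tendsto a atTop (𝓝 1) := tendsto_natCast_div_add_atTop 1
  have ha1 : ∀ j, 0 < a (j + 1) ∧ a (j + 1) < 1 := fun j => by
    simp only [a]
    refine ⟨by positivity, ?_⟩
    rw [div_lt_one (by positivity)]
    linarith
  choose σ hσ using fun j : ℕ => exists_erlang_mittagLeffler (ha1 j).1 (ha1 j).2.le (j + 1)
  have hlim : ∀ s : ℝ, 0 < s → Tendsto
      (fun j => ∫ x, Real.exp (-(s * x)) ∂(σ j : Measure ℝ≥0)) atTop (𝓝 (Real.exp s)⁻¹) := by
    intro s hs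
    simp only [hσ _ s hs.le]
    refine Tendsto.inv₀ ?_ (Real.exp_ne_zero s)
    have h1 : Tendsto (fun m : ℕ => (1 + s ^ a m / (m : ℝ)) ^ m) atTop (𝓝 (Real.exp s)) := by
      refine Real.tendsto_one_add_pow_exp_of_tendsto ?_
      have h2 : Tendsto (fun m => s ^ a m) atTop (𝓝 s) := by
        simpa [Function.comp_def] using (Real.continuousAt_const_rpow (b := 1) hs.ne').tendsto.comp ha
      refine h2.congr' ((eventually_ne_atTop 0).mono fun m hm => ?_)
      have : (m : ℝ) ≠ 0 := Nat.cast_ne_zero.mpr hm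
      field_simp
    exact h1.comp (tendsto_add_atTop_nat 1)
  exact ⟨fun j => a (j + 1), σ, ha1, ha.comp (tendsto_add_atTop_nat 1), hσ,
    fun n γ γ₀ hγ => tendstoOne_of_laplace (hlim 1 one_pos) (hlim 2 two_pos) hγ⟩

/-! ### Power classes and the three density statements -/

theorem map_mul_rpow_mem_MPHStarPow {Ω : Type*} [MeasurableSpace Ω] {n : ℕ} {α : ℝ}
    {ν : Fin n → ℝ} (hν : ∀ k, 0 < ν k) (μ : ProbabilityMeasure Ω)
    (F : SimpleFunc Ω (Fin n → ℝ≥0)) (m : ℕ) (σ : ProbabilityMeasure ℝ≥0)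
    (hσ : ∀ s : ℝ, 0 ≤ s → ∫ x, Real.exp (-(s * x)) ∂(σ : Measure ℝ≥0) =
      ((1 + s ^ α / ((m + 1 : ℕ) : ℝ)) ^ (m + 1))⁻¹) :
    (μ.prod σ).map (measurable_mul_rpow F.measurable fun k => 1 / ν k).aemeasurable ∈
      MPHStarPow n α ν := by
  refine ⟨_, map_simpleFunc_mul_mem_MPHStar μ (F.map fun b k => b k ^ ν k) m σ hσ, ?_⟩
  apply ProbabilityMeasure.toMeasure_injective
  simp only [ProbabilityMeasure.toMeasure_map]
  rw [Measure.map_map (measurable_invPow ν) (measurable_simpleFunc_mul _)]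
  congr 1
  funext z k
  simp only [Function.comp, invPow, SimpleFunc.map_apply]
  rw [NNReal.mul_rpow, ← NNReal.rpow_mul, mul_one_div_cancel (hν k).ne', NNReal.rpow_one]

theorem map_mul_rpow_marginal_ne_zero {Ω : Type*} [MeasurableSpace Ω] {n : ℕ}
    (μ : ProbabilityMeasure Ω) {F : Ω → Fin n → ℝ≥0} (hF : Measurable F)
    (hpos : ∀ x k, 0 < F x k) {σ : ProbabilityMeasure ℝ≥0} (h0 : (σ : Measure ℝ≥0) {0} = 0)
    (γ : Fin n → ℝ) (k : Fin n) :
    ((μ.prod σ).map (measurable_mul_rpow hF γ).aemeasurable : Measure (Fin n → ℝ≥0))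
      {y | y k ≠ 0} ≠ 0 := by
  have hset : MeasurableSet {y : Fin n → ℝ≥0 | y k ≠ 0} :=
    (measurable_pi_apply k) (measurableSet_singleton 0).compl
  rw [ProbabilityMeasure.toMeasure_map, Measure.map_apply (measurable_mul_rpow hF γ) hset]
  have hsub : (Set.univ : Set Ω) ×ˢ ({0}ᶜ : Set ℝ≥0) ⊆
      (fun z : Ω × ℝ≥0 => fun k => F z.1 k * z.2 ^ γ k) ⁻¹' {y | y k ≠ 0} := fun z hz =>
    mul_ne_zero (hpos z.1 k).ne' (NNReal.rpow_pos (pos_iff_ne_zero.mpr hz.2)).ne'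
  refine fun h => one_ne_zero (α := ENNReal) ?_
  rw [← le_zero_iff, ← h]
  refine le_trans (le_of_eq ?_) (measure_mono hsub)
  rw [ProbabilityMeasure.toMeasure_prod, Measure.prod_prod, measure_univ, one_mul,
    (prob_compl_eq_one_iff (measurableSet_singleton 0)).mpr h0]

end FractionalPhaseType

open Filter Topology FractionalPhaseType in
theorem mainTheorem3 (n : ℕ) :
    Dense {μ : ProbabilityMeasure (Fin n → ℝ≥0) |
      ∃ α : ℝ, 0 < α ∧ α < 1 ∧ μ ∈ FractionalPhaseType.MPHStar n α} ∧
    (∀ α : ℝ, 0 < α → α ≤ 1 →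
      Dense {μ : ProbabilityMeasure (Fin n → ℝ≥0) |
        ∃ ν : Fin n → ℝ, (∀ k, 0 < ν k) ∧ μ ∈ FractionalPhaseType.MPHStarPow n α ν}) ∧
    (∀ β : Fin n → ℝ, (∀ k, 0 < β k) →
      Dense {μ : ProbabilityMeasure (Fin n → ℝ≥0) |
        (∃ (α : ℝ) (ν : Fin n → ℝ), 0 < α ∧ α < 1 ∧ (∀ k, 0 < ν k ∧ α / ν k = β k) ∧
          μ ∈ FractionalPhaseType.MPHStarPow n α ν) ∧
        ∀ k, (μ : Measure (Fin n → ℝ≥0)) {y | y k ≠ 0} ≠ 0}) := by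
  refine ⟨?_, fun α h0 h1 => ?_, fun β hβ => ?_⟩
  · obtain ⟨α, σ, hα, -, hσ, H⟩ := exists_tendstoOne_erlang
    refine (H n (fun _ _ => 1) _ tendsto_const_nhds).dense fun μ F _ j =>
      ⟨α j, (hα j).1, (hα j).2, ?_⟩
    have h := map_simpleFunc_mul_mem_MPHStar μ F j (σ j) (hσ j)
    simpa only [NNReal.rpow_one] using h
  -- A single Mittag-Leffler variable suffices; only the exponents `1 / (j + 1)` vary.
  · obtain ⟨σ, hσ⟩ := exists_erlang_mittagLeffler h0 h1 1
    have hγ : Tendsto (fun (j : ℕ) (_ : Fin n) => 1 / ((j : ℝ) + 1)) atTop (𝓝 0) :=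
      tendsto_pi_nhds.mpr fun _ => tendsto_one_div_add_atTop_nhds_zero_nat
    refine (tendstoOne_const (measure_singleton_zero_of_laplace h0 (m := 0) hσ) hγ).dense
      fun μ F _ j => ⟨fun _ => (j : ℝ) + 1, fun _ => by positivity, ?_⟩
    exact map_mul_rpow_mem_MPHStarPow (fun _ => by positivity) μ F 0 σ hσ
  · obtain ⟨α, σ, hα, hlim, hσ, H⟩ := exists_tendstoOne_erlang
    -- The constraint forces `ν = α / β`, so the exponents `1 / ν = β / α` converge to `β` as `α →
    -- 1`.
    have hν : ∀ j k, 0 < α j / β k := fun j k => div_pos (hα j).1 (hβ k)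
    have hγ : Tendsto (fun j k => 1 / (α j / β k)) atTop (𝓝 fun k => 1 / (1 / β k)) :=
      tendsto_pi_nhds.mpr fun k => tendsto_const_nhds.div (hlim.div_const _)
        (one_div_pos.mpr (hβ k)).ne'
    refine (H n _ _ hγ).dense fun μ F hF j => ⟨⟨α j, fun k => α j / β k, (hα j).1, (hα j).2,
      fun k => ⟨hν j k, div_div_cancel₀ (hα j).1.ne'⟩,
      map_mul_rpow_mem_MPHStarPow (hν j) μ F j (σ j) (hσ j)⟩, fun k =>
      map_mul_rpow_marginal_ne_zero μ F.measurable hF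
        (measure_singleton_zero_of_laplace (hα j).1 (hσ j)) _ k⟩
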